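/- Let $P\subset A$ be an inclusion of unital $C^*$-algebras (with common unit) and let $E\colon A\to P$ be a conditional expectation of index-finite type, i.e. there are finitely many pairs $(u_k,v_k)\in A\times A$ (a quasi-basis) with $x=\sum_k u_kE(v_kx)=\sum_k E(xu_k)v_k$ for all $x\in A$. Let $C^*\langle A,e_P\rangle=\{\sum_{i=1}^n\lambda(x_i)e_P\lambda(y_i): n\in\mathbb N,\ x_i,y_i\in A\}$ be the $C^*$-basic construction, inside the adjointable operators on the Hilbert $P$-module $\mathcal E_E$ obtained by completing $A$ for $\langle x,y\rangle=E(x^*y)$, where $\lambda$ is left multiplication and $e_P$ is the Jones projection $e_P\eta(x)=\eta(E(x))$, with $\eta\colon A\to\mathcal E_E$ the natural map; $A$ is regarded as a subalgebra of $C^*\langle A,e_P\rangle$ via $\lambda$. Let $A_\infty=\ell^\infty(\mathbb N,A)/c_0(\mathbb N,A)$, with $A\subset A_\infty$ as the constant sequences, and let $P_\infty\subset A_\infty$ be the set of classes of bounded sequences in $P$. For positive elements $a,b$ of a $C^*$-algebra write $a\lesssim b$ if there is a sequence $(x_n)$ in that algebra with $\|x_nbx_n^*-a\|\to0$. A completely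 positive map $\varphi$ has order zero if $ab=ba=0$ implies $\varphi(a)\varphi(b)=\varphi(b)\varphi(a)=0$ for all positive $a,b$. For a nonzero positive $z\in A_\infty$ call $(e,r,(u_i))$ an approximate representation of $E$ for $z$ if $e\in P_\infty\cap P'$ and $r\in A_\infty\cap A'$ are positive contractions and $(u_i)$ is a finite family in $A$ such that (1) $e^{1/2}xe^{1/2}=E(x)e$ for every $x\in A$; (2) $\sum_iu_ieu_i^*=r$ and $re^{1/2}=e^{3/2}=e^{1/2}r$; (3) $1-r\lesssim z$ in $A_\infty$; (4) the map $P\ni x\mapsto xe$ is injective. Suppose that $E$ has the generalized tracial approximate representability, i.e. that an approximate representation of $E$ exists for every nonzero positive $z\in A_\infty$. Then for every nonzero positive $z\in A_\infty$ there is an injective completely positive map of order zero $\psi\colon C^*\langle A,e_P\rangle\to A_\infty$ such that (a) $\psi(a)=a\psi(1)=\psi(1)a$ for every $a\in A$; (b) $1-\psi(1)\lesssim z$ in $A_\infty$. Moreover, for every nonzero positive $z\in A_\infty$ and every approximate representation $(e,r,(u_i))$ of $E$ for $z$, the family $\{(u_i,u_i^*)\}$ is a quasi-basis for $E$. -/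

import Mathlib

open Filter Topology
open scoped BoundedContinuousFunction CStarAlgebra

set_option linter.unusedSectionVars false

noncomputable section

namespace CStarInclusion

section SequenceAlgebra

variable (A : Type*) [CStarAlgebra A]

/-- `c₀(ℕ, A)`, as an ideal of the C⋆-algebra `ℕ →ᵇ A = ℓ^∞(ℕ, A)` of bounded sequences. -/
def c0 : Ideal (ℕ →ᵇ A) where
  carrier := {f | Tendsto (fun n => ‖f n‖) atTop (𝓝 0)}
  add_mem' {f g} hf hg := by
    have := (tendsto_zero_iff_norm_tendsto_zero.2 hf).add (tendsto_zero_iff_norm_tendsto_zero.2 hg)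
    rw [add_zero] at this
    exact tendsto_zero_iff_norm_tendsto_zero.1 this
  zero_mem' := by simp
  smul_mem' c f hf := by
    refine squeeze_zero (fun n => norm_nonneg _) (fun n => ?_)
      (by simpa using (hf : Tendsto (fun n => ‖f n‖) atTop (𝓝 0)).const_mul ‖c‖)
    calc ‖c n * f n‖ ≤ ‖c n‖ * ‖f n‖ := norm_mul_le _ _
      _ ≤ ‖c‖ * ‖f n‖ := by gcongr; exact c.norm_coe_le_norm n

variable {A}

lemma mem_c0 {f : ℕ →ᵇ A} : f ∈ c0 A ↔ Tendsto (fun n => ‖f n‖) atTop (𝓝 0) := Iff.rfl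

instance : (c0 A).IsTwoSided where
  mul_mem_of_left {f} c hf := by
    rw [mem_c0] at hf ⊢
    refine squeeze_zero (fun n => norm_nonneg _) (fun n => ?_) (by simpa using hf.mul_const ‖c‖)
    calc ‖f n * c n‖ ≤ ‖f n‖ * ‖c n‖ := norm_mul_le _ _
      _ ≤ ‖f n‖ * ‖c‖ := by gcongr; exact c.norm_coe_le_norm n

lemma star_mem_c0 {f : ℕ →ᵇ A} (hf : f ∈ c0 A) : star f ∈ c0 A := by
  rw [mem_c0] at hf ⊢
  simpa using hf

instance : IsClosed (c0 A : Set (ℕ →ᵇ A)) := by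
  refine isClosed_of_closure_subset fun f hf => ?_
  rw [Metric.mem_closure_iff] at hf
  show Tendsto (fun n => ‖f n‖) atTop (𝓝 0)
  rw [Metric.tendsto_atTop]
  intro ε hε
  obtain ⟨g, hg, hfg⟩ := hf (ε / 2) (half_pos hε)
  obtain ⟨N, hN⟩ := Metric.tendsto_atTop.1 (mem_c0.1 hg) (ε / 2) (half_pos hε)
  refine ⟨N, fun n hn => ?_⟩
  have h1 := hN n hn
  simp only [dist_zero_right, norm_norm] at h1 ⊢
  have h2 : ‖f n - g n‖ ≤ dist f g := by
    rw [← dist_eq_norm]; exact BoundedContinuousFunction.dist_coe_le_dist n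
  have h3 : ‖f n‖ ≤ ‖f n - g n‖ + ‖g n‖ := by
    simpa using norm_add_le (f n - g n) (g n)
  linarith

variable (A) in
/-- The sequence algebra `A_∞ = ℓ^∞(ℕ, A) / c₀(ℕ, A)`. -/
def SeqAlgebra : Type _ := (ℕ →ᵇ A) ⧸ c0 A

namespace SeqAlgebra

instance : Ring (SeqAlgebra A) := inferInstanceAs (Ring ((ℕ →ᵇ A) ⧸ c0 A))

instance : Algebra ℂ (SeqAlgebra A) := inferInstanceAs (Algebra ℂ ((ℕ →ᵇ A) ⧸ c0 A))

/-- The quotient norm. -/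
instance : NormedAddCommGroup (SeqAlgebra A) :=
  inferInstanceAs (NormedAddCommGroup ((ℕ →ᵇ A) ⧸ c0 A))

instance : CompleteSpace (SeqAlgebra A) := inferInstanceAs (CompleteSpace ((ℕ →ᵇ A) ⧸ c0 A))

/-- The class of a bounded sequence. -/
def mkAlg : (ℕ →ᵇ A) →ₐ[ℂ] SeqAlgebra A := Ideal.Quotient.mkₐ ℂ (c0 A)

lemma mkAlg_surjective : Function.Surjective (mkAlg (A := A)) := Ideal.Quotient.mk_surjective

lemma mkAlg_eq_zero {f : ℕ →ᵇ A} : mkAlg f = 0 ↔ f ∈ c0 A := Ideal.Quotient.eq_zero_iff_mem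

lemma norm_mkAlg_le (f : ℕ →ᵇ A) : ‖mkAlg f‖ ≤ ‖f‖ := Submodule.Quotient.norm_mk_le (c0 A) f

lemma exists_mkAlg_lt (x : SeqAlgebra A) {r : ℝ} (h : ‖x‖ < r) : ∃ f, mkAlg f = x ∧ ‖f‖ < r := by
  obtain ⟨f, hf, hf'⟩ := Submodule.Quotient.norm_mk_lt (S := c0 A) x (sub_pos.2 h)
  exact ⟨f, hf, hf'.trans_eq (add_sub_cancel _ _)⟩

instance : Star (SeqAlgebra A) where
  star := Quotient.map' star fun f g h => by
    have h' : f - g ∈ c0 A := (Submodule.quotientRel_def _).1 h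
    refine (Submodule.quotientRel_def _).2 ?_
    rw [← star_sub]
    exact star_mem_c0 h'

lemma star_mkAlg (f : ℕ →ᵇ A) : star (mkAlg f) = mkAlg (star f) := rfl

instance : StarRing (SeqAlgebra A) where
  star_involutive x := by
    obtain ⟨f, rfl⟩ := mkAlg_surjective x
    rw [star_mkAlg, star_mkAlg, star_star]
  star_mul x y := by
    obtain ⟨f, rfl⟩ := mkAlg_surjective x
    obtain ⟨g, rfl⟩ := mkAlg_surjective y
    rw [← map_mul, star_mkAlg, star_mkAlg, star_mkAlg, star_mul, map_mul]
  star_add x y := by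
    obtain ⟨f, rfl⟩ := mkAlg_surjective x
    obtain ⟨g, rfl⟩ := mkAlg_surjective y
    rw [← map_add, star_mkAlg, star_mkAlg, star_mkAlg, star_add, map_add]

instance : NormedRing (SeqAlgebra A) where
  dist_eq x y := NormedAddCommGroup.dist_eq x y
  norm_mul_le x y := by
    refine le_of_forall_pos_lt_add fun ε hε => ?_
    have hc : Tendsto (fun t : ℝ => (‖x‖ + t) * (‖y‖ + t)) (𝓝[>] 0) (𝓝 (‖x‖ * ‖y‖)) := by
      have : Continuous fun t : ℝ => (‖x‖ + t) * (‖y‖ + t) := by fun_prop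
      simpa using (this.tendsto 0).mono_left nhdsWithin_le_nhds
    obtain ⟨t, ht, ht0⟩ :=
      ((hc.eventually_lt_const (lt_add_of_pos_right _ hε)).and self_mem_nhdsWithin).exists
    have ht0 : 0 < t := ht0
    obtain ⟨f, rfl, hf⟩ := exists_mkAlg_lt x (lt_add_of_pos_right _ ht0)
    obtain ⟨g, rfl, hg⟩ := exists_mkAlg_lt y (lt_add_of_pos_right _ ht0)
    refine lt_of_le_of_lt ?_ ht
    rw [← map_mul]
    refine (norm_mkAlg_le _).trans ((norm_mul_le _ _).trans ?_)
    gcongr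

instance : NormedAlgebra ℂ (SeqAlgebra A) where
  norm_smul_le c x := by
    have := norm_smul_le c (show (ℕ →ᵇ A) ⧸ c0 A from x)
    exact this

instance : StarModule ℂ (SeqAlgebra A) where
  star_smul c x := by
    obtain ⟨f, rfl⟩ := mkAlg_surjective x
    rw [← map_smul, star_mkAlg, star_mkAlg, star_smul, map_smul]

instance : CStarRing (SeqAlgebra A) where
  norm_mul_self_le x := by
    obtain ⟨a, rfl⟩ := mkAlg_surjective x
    refine le_of_forall_pos_le_add fun ε hε => ?_
    rw [star_mkAlg, ← map_mul]
    obtain ⟨f, hf, hlt⟩ := exists_mkAlg_lt (mkAlg (star a * a))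
      (lt_add_of_pos_right _ (half_pos hε))
    have hmem : star a * a - f ∈ c0 A := by
      rw [← mkAlg_eq_zero, map_sub, hf, sub_self]
    obtain ⟨N, hN⟩ := Metric.tendsto_atTop.1 (mem_c0.1 hmem) (ε / 2) (half_pos hε)
    set c := ‖mkAlg (star a * a)‖ + ε with hc
    have hc0 : 0 ≤ c := by positivity
    have hbound : ∀ n, N ≤ n → ‖a n‖ ≤ √c := fun n hn => by
      refine Real.le_sqrt_of_sq_le ?_
      have h1 := hN n hn
      simp only [dist_zero_right, norm_norm] at h1
      have h2 : ‖(star a * a) n‖ = ‖a n‖ ^ 2 := by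
        rw [sq]; exact CStarRing.norm_star_mul_self
      have h3 : ‖(star a * a) n‖ ≤ ‖(star a * a - f) n‖ + ‖f n‖ := by
        simpa using norm_add_le ((star a * a - f) n) (f n)
      have h4 := f.norm_coe_le_norm n
      linarith
    let b : ℕ →ᵇ A := BoundedContinuousFunction.ofNormedAddCommGroup
      (fun n => if N ≤ n then a n else 0) continuous_of_discreteTopology (√c) fun n => by
        split_ifs with h
        · exact hbound n h
        · simp
    have hb : ‖b‖ ≤ √c :=
      BoundedContinuousFunction.norm_ofNormedAddCommGroup_le _ (Real.sqrt_nonneg _) _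
    have hab : mkAlg a = mkAlg b := by
      rw [← sub_eq_zero, ← map_sub, mkAlg_eq_zero, mem_c0]
      refine tendsto_const_nhds.congr' ?_
      filter_upwards [eventually_ge_atTop N] with n hn
      simp [b, hn]
    have h5 : ‖mkAlg a‖ ≤ √c := hab ▸ (norm_mkAlg_le b).trans hb
    calc ‖mkAlg a‖ * ‖mkAlg a‖ ≤ √c * √c := by gcongr
      _ = c := Real.mul_self_sqrt hc0

instance : CStarAlgebra (SeqAlgebra A) where

/-- The order given by the cone of positive elements. -/
instance : PartialOrder (SeqAlgebra A) := CStarAlgebra.spectralOrder _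

instance : StarOrderedRing (SeqAlgebra A) := CStarAlgebra.spectralOrderedRing _

/-- The class of a bounded sequence, as a `⋆`-homomorphism `ℓ^∞(ℕ, A) → A_∞`. -/
def mk : (ℕ →ᵇ A) →⋆ₐ[ℂ] SeqAlgebra A := { mkAlg with map_star' := fun f => (star_mkAlg f).symm }

/-- The embedding of `A` into `A_∞` as constant sequences. -/
def const : A →⋆ₐ[ℂ] SeqAlgebra A where
  toFun a := mk (BoundedContinuousFunction.const ℕ a)
  map_one' := map_one mk
  map_mul' a b := map_mul mk (BoundedContinuousFunction.const ℕ a) (.const ℕ b)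
  map_zero' := map_zero mk
  map_add' a b := map_add mk (BoundedContinuousFunction.const ℕ a) (.const ℕ b)
  commutes' c := AlgHomClass.commutes mk c
  map_star' a := map_star mk (BoundedContinuousFunction.const ℕ a)

/-- `P_∞ ⊆ A_∞`: the classes of bounded sequences with values in `P`. -/
def ofSubalgebra (P : StarSubalgebra ℂ A) : Set (SeqAlgebra A) :=
  {x | ∃ f : ℕ →ᵇ A, (∀ n, f n ∈ P) ∧ mk f = x}

end SeqAlgebra

end SequenceAlgebra

section ConditionalExpectation

variable {A : Type*} [CStarAlgebra A] [PartialOrder A] [StarOrderedRing A]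

/-- A conditional expectation of a unital C⋆-algebra `A` onto a unital C⋆-subalgebra `P`: a positive
`P`-bimodule projection of `A` onto `P`. -/
structure ConditionalExpectation (P : StarSubalgebra ℂ A) extends A →ₗ[ℂ] P where
  /-- `E` is the identity on `P`. -/
  map_coe' : ∀ p : P, toFun p = p
  /-- `E` is left `P`-linear. -/
  map_coe_mul' : ∀ (p : P) (a : A), toFun (p * a) = p * toFun a
  /-- `E` is right `P`-linear. -/
  map_mul_coe' : ∀ (a : A) (p : P), toFun (a * p) = toFun a * p
  /-- `E` is positive. -/
  map_nonneg' : ∀ a : A, 0 ≤ a → 0 ≤ (toFun a : A)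

namespace ConditionalExpectation

variable {P : StarSubalgebra ℂ A}

instance : FunLike (ConditionalExpectation P) A P where
  coe E := E.toFun
  coe_injective E F h := by
    cases E; cases F; congr; exact DFunLike.coe_injective h

instance : LinearMapClass (ConditionalExpectation P) ℂ A P where
  map_add E := map_add E.toLinearMap
  map_smulₛₗ E := map_smul E.toLinearMap

variable (E : ConditionalExpectation P)

lemma map_coe (p : P) : E p = p := E.map_coe' p
lemma map_coe_mul (p : P) (a : A) : E (p * a) = p * E a := E.map_coe_mul' p a
lemma map_mul_coe (a : A) (p : P) : E (a * p) = E a * p := E.map_mul_coe' a p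
lemma map_nonneg {a : A} (ha : 0 ≤ a) : 0 ≤ (E a : A) := E.map_nonneg' a ha

lemma map_mono {a b : A} (h : a ≤ b) : (E a : A) ≤ E b := by
  have := E.map_nonneg (sub_nonneg.2 h)
  rw [map_sub] at this
  exact sub_nonneg.1 this

lemma map_star (a : A) : E (star a) = star (E a) := by
  have hsa : ∀ a : A, IsSelfAdjoint a → star (E a) = E a := fun a ha => by
    apply Subtype.ext
    have h1 : IsSelfAdjoint (E (a⁺ : A) : A) :=
      (E.map_nonneg (CFC.posPart_nonneg a)).isSelfAdjoint
    have h2 : IsSelfAdjoint (E (a⁻ : A) : A) :=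
      (E.map_nonneg (CFC.negPart_nonneg a)).isSelfAdjoint
    have h3 : (E a : A) = E (a⁺ : A) - E (a⁻ : A) := by
      conv_lhs => rw [← CFC.posPart_sub_negPart a ha, map_sub]
      rfl
    rw [StarMemClass.coe_star, h3]
    exact h1.sub h2
  have ha := realPart_add_I_smul_imaginaryPart a
  have h1 := hsa _ (realPart a).2
  have h2 := hsa _ (imaginaryPart a).2
  rw [← ha]
  simp only [star_add, star_smul, map_add, map_smul, h1, h2]
  rw [(realPart a).2.star_eq, (imaginaryPart a).2.star_eq]

/-- `{(u_k, v_k)}` is a quasi-basis for `E`: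
`x = ∑ u_k E(v_k x) = ∑ E(x u_k) v_k` for all `x ∈ A`. -/
def IsQuasiBasis {n : ℕ} (u v : Fin n → A) : Prop :=
  ∀ x : A, x = ∑ k, u k * (E (v k * x) : A) ∧ x = ∑ k, (E (x * u k) : A) * v k

/-- `E` is of index-finite type. -/
class IsIndexFinite : Prop where
  /-- There is a quasi-basis for `E`. -/
  exists_quasiBasis : ∃ (n : ℕ) (u v : Fin n → A), E.IsQuasiBasis u v

lemma norm_map_star_mul_le (a x : A) :
    ‖E (star (a * x) * (a * x))‖ ≤ ‖a‖ ^ 2 * ‖E (star x * x)‖ := by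
  have h : star (a * x) * (a * x) ≤ ‖a‖ ^ 2 • (star x * x) := by
    have h1 := CStarAlgebra.star_left_conjugate_le_norm_smul (a := x) (b := star a * a)
      (IsSelfAdjoint.star_mul_self a)
    rw [CStarRing.norm_star_mul_self, ← sq] at h1
    simpa only [star_mul, mul_assoc] using h1
  have h2 := E.map_mono h
  have h3 : (E (‖a‖ ^ 2 • (star x * x)) : A) = ‖a‖ ^ 2 • (E (star x * x) : A) := by
    rw [← Complex.coe_smul, map_smul]
    exact Complex.coe_smul _ _
  rw [h3] at h2
  have h4 := CStarAlgebra.norm_le_norm_of_nonneg_of_le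
    (E.map_nonneg (star_mul_self_nonneg (a * x))) h2
  rwa [norm_smul, Real.norm_of_nonneg (by positivity)] at h4

/-- The Cauchy–Schwarz inequality for `(x, y) ↦ E(x⋆ y)`. -/
lemma norm_map_star_mul_sq_le (x y : A) :
    ‖E (star x * y)‖ ^ 2 ≤ ‖E (star x * x)‖ * ‖E (star y * y)‖ := by
  set b : P := E (star x * y) with hb
  have hb' : E (star y * x) = star b := by rw [hb, ← E.map_star]; simp
  set N := ‖E (star x * x)‖ with hN
  have key : ∀ t : ℝ, 0 < t → N ≤ t → ‖b‖ ^ 2 ≤ t * ‖E (star y * y)‖ := fun t ht hNt => by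
    have h0 := E.map_nonneg (star_mul_self_nonneg (x * (b : A) - (t : ℂ) • y))
    have h1 : E (star (x * (b : A) - (t : ℂ) • y) * (x * (b : A) - (t : ℂ) • y)) =
        star b * E (star x * x) * b - (2 * t : ℂ) • (star b * b)
          + ((t : ℂ) ^ 2) • E (star y * y) := by
      have e1 : star (x * (b : A) - (t : ℂ) • y) * (x * (b : A) - (t : ℂ) • y) =
          ((star b : P) : A) * (star x * x) * (b : A) - (t : ℂ) • (((star b : P) : A) * (star x * y))
            - (t : ℂ) • ((star y * x) * (b : A)) + ((t : ℂ) ^ 2) • (star y * y) := by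
        simp only [star_sub, star_mul, star_smul, mul_sub, sub_mul, smul_mul_assoc, mul_smul_comm,
          StarMemClass.coe_star, mul_assoc, RCLike.star_def, Complex.conj_ofReal, sq, mul_smul,
          smul_sub]
        abel
      rw [e1]
      simp only [map_add, map_sub, map_smul, E.map_mul_coe, E.map_coe_mul, ← hb, hb', two_mul,
        add_smul]
      abel
    rw [h1] at h0
    have h2 : (star b * E (star x * x) * b : A) ≤ t • (star b * b : A) := by
      have h3 := CStarAlgebra.star_left_conjugate_le_norm_smul (a := (b : A))
        (b := (E (star x * x) : A)) (E.map_nonneg (star_mul_self_nonneg x)).isSelfAdjoint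
      refine h3.trans ?_
      exact smul_le_smul_of_nonneg_right hNt (star_mul_self_nonneg (b : A))
    have h4 : t • (star b * b : A) ≤ t ^ 2 • (E (star y * y) : A) := by
      have h5 : ((star b * E (star x * x) * b - (2 * t : ℂ) • (star b * b)
          + ((t : ℂ) ^ 2) • E (star y * y) : P) : A) = (star b * E (star x * x) * b : A)
          - (2 * t) • (star b * b : A) + t ^ 2 • (E (star y * y) : A) := by
        rw [← Complex.coe_smul, ← Complex.coe_smul]
        push_cast
        rfl
      rw [h5] at h0
      have h6 : (0 : A) ≤ t • (star b * b : A) - (2 * t) • (star b * b : A)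
          + t ^ 2 • (E (star y * y) : A) := by
        refine h0.trans ?_
        gcongr
      have h7 : t • (star b * b : A) - (2 * t) • (star b * b : A)
          + t ^ 2 • (E (star y * y) : A) = t ^ 2 • (E (star y * y) : A) - t • (star b * b : A) := by
        rw [two_mul, add_smul]; abel
      rw [h7] at h6
      exact sub_nonneg.1 h6
    have h8 := CStarAlgebra.norm_le_norm_of_nonneg_of_le
      (smul_nonneg ht.le (star_mul_self_nonneg (b : A))) h4
    rw [norm_smul, norm_smul, CStarRing.norm_star_mul_self, Real.norm_of_nonneg ht.le,
      Real.norm_of_nonneg (by positivity)] at h8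
    have h9 : ‖(b : A)‖ ^ 2 ≤ t * ‖(E (star y * y) : A)‖ := by
      refine le_of_mul_le_mul_left ?_ ht
      nlinarith
    exact h9
  have hlim : Tendsto (fun t : ℝ => t * ‖E (star y * y)‖) (𝓝[>] N) (𝓝 (N * ‖E (star y * y)‖)) := by
    have : Continuous fun t : ℝ => t * ‖E (star y * y)‖ := by fun_prop
    exact (this.tendsto N).mono_left nhdsWithin_le_nhds
  refine ge_of_tendsto hlim ?_
  filter_upwards [self_mem_nhdsWithin] with t ht
  exact key t (lt_of_le_of_lt (norm_nonneg _) ht) (le_of_lt ht)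

/-- A conditional expectation of index-finite type is automatically faithful. -/
lemma faithful [E.IsIndexFinite] {x : A} (hx : E (star x * x) = 0) : x = 0 := by
  obtain ⟨n, u, v, h⟩ := IsIndexFinite.exists_quasiBasis (E := E)
  have h0 : ∀ y : A, E (y * x) = 0 := fun y => by
    have h1 := E.norm_map_star_mul_sq_le (star y) x
    rw [star_star, hx, norm_zero, mul_zero] at h1
    exact norm_eq_zero.1 (sq_eq_zero_iff.1 (le_antisymm h1 (sq_nonneg _)))
  rw [(h x).1]
  exact Finset.sum_eq_zero fun k _ => by simp [h0]

end ConditionalExpectation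

end ConditionalExpectation

section HilbertModule

open UniformSpace

variable {A : Type*} [CStarAlgebra A] [PartialOrder A] [StarOrderedRing A]
  {P : StarSubalgebra ℂ A}

/-- A copy of the vector space `A`, carrying the `P`-valued form `⟨x, y⟩ = E(x⋆ y)` and the
associated seminorm `‖E(x⋆ x)‖^{1/2}`. -/
def PreModule (_E : ConditionalExpectation P) : Type _ := A

namespace PreModule

variable {E : ConditionalExpectation P}

instance : AddCommGroup (PreModule E) := inferInstanceAs (AddCommGroup A)

instance : Module ℂ (PreModule E) := inferInstanceAs (Module ℂ A)

/-- The identity map from `A` to its copy. -/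
def of (E : ConditionalExpectation P) : A ≃ₗ[ℂ] PreModule E := LinearEquiv.refl ℂ A

instance : Inner P (PreModule E) where
  inner x y := E (star ((of E).symm x) * (of E).symm y)

lemma inner_def (x y : A) : inner P (of E x) (of E y) = E (star x * y) := rfl

/-- The sesquilinear form `⟨x, y⟩ = E(x⋆ y)`. -/
def innerₛₗ : PreModule E →ₗ⋆[ℂ] PreModule E →ₗ[ℂ] P :=
  LinearMap.mk₂'ₛₗ (starRingEnd ℂ) (RingHom.id ℂ)
    (fun x y => E (star ((of E).symm x) * (of E).symm y))
    (fun x y z => by simp [add_mul]) (fun c x y => by simp)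
    (fun x y z => by simp [mul_add]) (fun c x y => by simp)

lemma innerₛₗ_apply (x y : PreModule E) : innerₛₗ x y = inner P x y := rfl

/-- The seminorm `‖x‖ = ‖⟨x, x⟩‖^{1/2}`. -/
instance : Norm (PreModule E) where
  norm x := √‖inner P x x‖

lemma norm_def (x : PreModule E) : ‖x‖ = √‖inner P x x‖ := rfl

lemma norm_sq (x : PreModule E) : ‖x‖ ^ 2 = ‖inner P x x‖ := Real.sq_sqrt (norm_nonneg _)

lemma norm_inner_le (x y : PreModule E) : ‖inner P x y‖ ≤ ‖x‖ * ‖y‖ := by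
  refine abs_le_of_sq_le_sq' ?_ (by simp only [norm_def]; positivity) |>.2
  rw [mul_pow, norm_sq, norm_sq]
  exact E.norm_map_star_mul_sq_le _ _

/-- The axioms of a seminorm. -/
lemma seminormedCore : SeminormedSpace.Core ℂ (PreModule E) where
  norm_nonneg x := Real.sqrt_nonneg _
  norm_smul c x := by
    have h : inner P (c • x) (c • x) = (starRingEnd ℂ c * c) • inner P x x := by
      rw [← innerₛₗ_apply, ← innerₛₗ_apply, LinearMap.map_smul, LinearMap.map_smulₛₗ innerₛₗ,
        LinearMap.smul_apply, smul_smul, mul_comm]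
    rw [norm_def, h, norm_smul, norm_mul, RCLike.norm_conj, Real.sqrt_mul (by positivity),
      Real.sqrt_mul_self (norm_nonneg _), norm_def]
  norm_triangle x y := by
    have h0 : ∀ z : PreModule E, 0 ≤ ‖z‖ := fun z => Real.sqrt_nonneg _
    refine abs_le_of_sq_le_sq' ?_ (add_nonneg (h0 x) (h0 y)) |>.2
    have h : inner P (x + y) (x + y) =
        inner P x x + inner P x y + (inner P y x + inner P y y) := by
      simp only [← innerₛₗ_apply, map_add, LinearMap.add_apply]
      abel
    rw [norm_sq, h]
    calc _ ≤ ‖inner P x x‖ + ‖inner P x y‖ + (‖inner P y x‖ + ‖inner P y y‖) :=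
          (norm_add_le _ _).trans (add_le_add (norm_add_le _ _) (norm_add_le _ _))
      _ ≤ ‖x‖ ^ 2 + ‖x‖ * ‖y‖ + (‖y‖ * ‖x‖ + ‖y‖ ^ 2) := by
          rw [norm_sq, norm_sq]
          gcongr <;> exact norm_inner_le _ _
      _ = _ := by ring

instance : SeminormedAddCommGroup (PreModule E) := .ofCore seminormedCore

instance : NormedSpace ℂ (PreModule E) where
  norm_smul_le c x := (seminormedCore.norm_smul c x).le

lemma star_inner (x y : PreModule E) : star (inner P x y) = inner P y x := by
  show star (E _) = E _
  rw [← E.map_star]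
  simp

lemma continuous_inner : Continuous fun p : PreModule E × PreModule E => inner P p.1 p.2 := by
  let B : PreModule E →L⋆[ℂ] PreModule E →L[ℂ] P :=
    LinearMap.mkContinuous₂ innerₛₗ 1 fun x y => by
      rw [innerₛₗ_apply, one_mul]; exact norm_inner_le x y
  show Continuous fun p : PreModule E × PreModule E => B p.1 p.2
  fun_prop

end PreModule

/-- The Hilbert `P`-module `ℰ_E`: the completion of `A` with respect to `‖E(x⋆ x)‖^{1/2}`. Its
`P`-valued inner product is the continuous extension of `⟨x, y⟩ = E(x⋆ y)`. -/
abbrev HilbertModule (E : ConditionalExpectation P) : Type _ := Completion (PreModule E)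

namespace HilbertModule

variable {E : ConditionalExpectation P}

/-- The natural map `η_E : A → ℰ_E`. -/
def eta (E : ConditionalExpectation P) : A →ₗ[ℂ] HilbertModule E :=
  (Completion.toComplₗᵢ (𝕜 := ℂ) (E := PreModule E)).toLinearMap ∘ₗ (PreModule.of E).toLinearMap

lemma eta_apply (a : A) : eta E a = (PreModule.of E a : Completion (PreModule E)) := rfl

lemma denseRange_eta : DenseRange (eta E) :=
  Completion.denseRange_coe (α := PreModule E)

lemma norm_eta_sq (a : A) : ‖eta E a‖ ^ 2 = ‖E (star a * a)‖ := by
  rw [eta_apply, Completion.norm_coe, PreModule.norm_sq]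
  rfl

variable [IsClosed (P : Set A)]

lemma continuous_inner :
    Continuous fun p : HilbertModule E × HilbertModule E => inner P p.1 p.2 := by
  let inner' : PreModule E →+ PreModule E →+ P :=
    { toFun := fun x => (PreModule.innerₛₗ x).toAddMonoidHom
      map_zero' := by ext x; simp
      map_add' := fun x y => by ext z; simp }
  have : Continuous fun p : PreModule E × PreModule E => inner' p.1 p.2 :=
    PreModule.continuous_inner
  exact (Completion.isDenseInducing_toCompl (PreModule E)).extend_Z_bilin
    (Completion.isDenseInducing_toCompl (PreModule E)) this

@[fun_prop]
lemma _root_.Continuous.hilbertModule_inner {X : Type*} [TopologicalSpace X]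
    {f g : X → HilbertModule E} (hf : Continuous f) (hg : Continuous g) :
    Continuous fun x => inner P (f x) (g x) :=
  continuous_inner.comp (hf.prodMk hg)

lemma inner_eta (a b : A) : inner P (eta E a) (eta E b) = E (star a * b) :=
  (Completion.isDenseInducing_coe.prodMap Completion.isDenseInducing_coe).extend_eq
    PreModule.continuous_inner (PreModule.of E a, PreModule.of E b)

lemma inner_add_right (x y z : HilbertModule E) :
    inner P x (y + z) = inner P x y + inner P x z := by
  refine denseRange_eta.induction_on₃ (p := fun x y z : HilbertModule E =>
    inner P x (y + z) = inner P x y + inner P x z)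
    (isClosed_eq (by fun_prop) (by fun_prop)) (fun a b c => ?_) x y z
  rw [← map_add, inner_eta, inner_eta, inner_eta, mul_add, map_add]

lemma inner_smul_right (c : ℂ) (x y : HilbertModule E) : inner P x (c • y) = c • inner P x y := by
  refine denseRange_eta.induction_on₂ (p := fun x y : HilbertModule E =>
    inner P x (c • y) = c • inner P x y)
    (isClosed_eq (continuous_fst.hilbertModule_inner (continuous_snd.const_smul c))
      (continuous_inner.const_smul c)) (fun a b => ?_) x y
  rw [← map_smul, inner_eta, inner_eta, mul_smul_comm, map_smul]

lemma star_inner (x y : HilbertModule E) : star (inner P x y) = inner P y x := by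
  refine denseRange_eta.induction_on₂ (p := fun x y : HilbertModule E =>
    star (inner P x y) = inner P y x)
    (isClosed_eq (by fun_prop) (by fun_prop)) (fun a b => ?_) x y
  rw [inner_eta, inner_eta, ← E.map_star]
  simp

lemma norm_sq (x : HilbertModule E) : ‖x‖ ^ 2 = ‖inner P x x‖ := by
  refine denseRange_eta.induction_on (p := fun x : HilbertModule E => ‖x‖ ^ 2 = ‖inner P x x‖) x
    (isClosed_eq (by fun_prop) (by fun_prop)) (fun a => ?_)
  rw [inner_eta, norm_eta_sq]

lemma norm_inner_le (x y : HilbertModule E) : ‖inner P x y‖ ≤ ‖x‖ * ‖y‖ := by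
  refine denseRange_eta.induction_on₂ (p := fun x y : HilbertModule E =>
    ‖inner P x y‖ ≤ ‖x‖ * ‖y‖) (isClosed_le (by fun_prop) (by fun_prop)) (fun a b => ?_) x y
  rw [inner_eta]
  have h := PreModule.norm_inner_le (PreModule.of E a) (PreModule.of E b)
  rw [← Completion.norm_coe (PreModule.of E a), ← Completion.norm_coe (PreModule.of E b)] at h
  exact h

lemma inner_sub_right (x y z : HilbertModule E) :
    inner P x (y - z) = inner P x y - inner P x z := by
  have h := inner_add_right x (y - z) z
  rw [sub_add_cancel] at h
  rw [h, add_sub_cancel_right]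

lemma inner_add_left (x y z : HilbertModule E) :
    inner P (x + y) z = inner P x z + inner P y z := by
  rw [← star_inner, inner_add_right, star_add, star_inner, star_inner]

lemma inner_smul_left (c : ℂ) (x y : HilbertModule E) :
    inner P (c • x) y = star c • inner P x y := by
  rw [← star_inner, inner_smul_right, star_smul, star_inner]

lemma ext_inner {x y : HilbertModule E} (h : ∀ z, inner P z x = inner P z y) : x = y := by
  have h0 : ‖x - y‖ ^ 2 = 0 := by
    rw [norm_sq, inner_sub_right, h, sub_self, norm_zero]
  rwa [sq_eq_zero_iff, norm_eq_zero, sub_eq_zero] at h0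

end HilbertModule

end HilbertModule

section AdjointableOperators

variable {A : Type*} [CStarAlgebra A] [PartialOrder A] [StarOrderedRing A]
  {P : StarSubalgebra ℂ A} [IsClosed (P : Set A)]

/-- `S` is an adjoint of `T`, with respect to the `P`-valued inner product of `ℰ_E`. -/
def IsAdjoint {E : ConditionalExpectation P} (T S : HilbertModule E →L[ℂ] HilbertModule E) : Prop :=
  ∀ x y : HilbertModule E, inner P (T x) y = inner P x (S y)

namespace IsAdjoint

variable {E : ConditionalExpectation P} {T T' S S' : HilbertModule E →L[ℂ] HilbertModule E}

lemma unique (h : IsAdjoint T S) (h' : IsAdjoint T S') : S = S' :=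
  ContinuousLinearMap.ext fun y => HilbertModule.ext_inner fun x => by rw [← h, ← h']

lemma symm (h : IsAdjoint T S) : IsAdjoint S T := fun x y => by
  rw [← HilbertModule.star_inner, ← h, HilbertModule.star_inner]

lemma add (h : IsAdjoint T S) (h' : IsAdjoint T' S') : IsAdjoint (T + T') (S + S') := fun x y => by
  rw [_root_.add_apply, _root_.add_apply, HilbertModule.inner_add_left,
    HilbertModule.inner_add_right, h, h']

lemma mul (h : IsAdjoint T S) (h' : IsAdjoint T' S') : IsAdjoint (T * T') (S' * S) := fun x y => by
  show inner P (T (T' x)) y = inner P x (S' (S y))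
  rw [h, h']

lemma smul (c : ℂ) (h : IsAdjoint T S) : IsAdjoint (c • T) (star c • S) := fun x y => by
  rw [_root_.smul_apply, _root_.smul_apply,
    HilbertModule.inner_smul_left, HilbertModule.inner_smul_right, h]

lemma one : IsAdjoint (1 : HilbertModule E →L[ℂ] HilbertModule E) 1 := fun _ _ => rfl

lemma zero : IsAdjoint (0 : HilbertModule E →L[ℂ] HilbertModule E) 0 := by
  simpa using one.smul (0 : ℂ) (E := E)

lemma norm_sq_le (h : IsAdjoint T S) : ‖T‖ ^ 2 ≤ ‖S * T‖ := by
  have h1 : ‖T‖ ≤ √‖S * T‖ := by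
    refine T.opNorm_le_bound (Real.sqrt_nonneg _) fun x => ?_
    refine abs_le_of_sq_le_sq' ?_ (by positivity) |>.2
    rw [mul_pow, Real.sq_sqrt (norm_nonneg _), HilbertModule.norm_sq, h]
    calc ‖inner P x (S (T x))‖ ≤ ‖x‖ * ‖S (T x)‖ := HilbertModule.norm_inner_le _ _
      _ ≤ ‖x‖ * (‖S * T‖ * ‖x‖) := by gcongr; exact (S * T).le_opNorm x
      _ = ‖S * T‖ * ‖x‖ ^ 2 := by ring
  calc ‖T‖ ^ 2 ≤ √‖S * T‖ ^ 2 := by gcongr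
    _ = _ := Real.sq_sqrt (norm_nonneg _)

lemma norm_le (h : IsAdjoint T S) : ‖T‖ ≤ ‖S‖ := by
  have h1 := h.norm_sq_le.trans (norm_mul_le S T)
  rcases (norm_nonneg T).eq_or_lt with h0 | h0
  · rw [← h0]; exact norm_nonneg S
  · rw [sq] at h1
    exact le_of_mul_le_mul_right h1 h0

lemma norm_eq (h : IsAdjoint T S) : ‖T‖ = ‖S‖ := le_antisymm h.norm_le h.symm.norm_le

end IsAdjoint

/-- `ℒ(ℰ_E)`, the adjointable bounded operators on the Hilbert module `ℰ_E`. -/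
def adjointable (E : ConditionalExpectation P) :
    Subalgebra ℂ (HilbertModule E →L[ℂ] HilbertModule E) where
  carrier := {T | ∃ S, IsAdjoint T S}
  mul_mem' := fun ⟨S, h⟩ ⟨S', h'⟩ => ⟨S' * S, h.mul h'⟩
  add_mem' := fun ⟨S, h⟩ ⟨S', h'⟩ => ⟨S + S', h.add h'⟩
  algebraMap_mem' c := ⟨star c • 1, by rw [Algebra.algebraMap_eq_smul_one]; exact .smul c .one⟩

namespace adjointable

variable {E : ConditionalExpectation P}

/-- The adjoint operation. -/
instance : Star (adjointable E) where
  star T := ⟨T.2.choose, T.1, T.2.choose_spec.symm⟩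

lemma isAdjoint_star (T : adjointable E) :
    IsAdjoint (T : HilbertModule E →L[ℂ] HilbertModule E) (star T : adjointable E) :=
  T.2.choose_spec

lemma star_eq {T S : adjointable E} (h : IsAdjoint T.1 S.1) : star T = S :=
  Subtype.ext ((isAdjoint_star T).unique h)

instance : StarRing (adjointable E) where
  star_involutive T := star_eq (isAdjoint_star T).symm
  star_mul S T := star_eq ((isAdjoint_star S).mul (isAdjoint_star T))
  star_add S T := star_eq ((isAdjoint_star S).add (isAdjoint_star T))

instance : StarModule ℂ (adjointable E) where
  star_smul c T := star_eq ((isAdjoint_star T).smul c)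

instance : CStarRing (adjointable E) where
  norm_mul_self_le T := by rw [← sq]; exact (isAdjoint_star T).norm_sq_le

lemma isClosed_adjointable :
    IsClosed (adjointable E : Set (HilbertModule E →L[ℂ] HilbertModule E)) := by
  refine isClosed_of_closure_subset fun T hT => ?_
  obtain ⟨u, hu, hlim⟩ := mem_closure_iff_seq_limit.1 hT
  choose v hv using hu
  have hc : CauchySeq v := by
    have h := hlim.cauchySeq
    rw [Metric.cauchySeq_iff] at h ⊢
    intro ε hε
    obtain ⟨N, hN⟩ := h ε hε
    refine ⟨N, fun m hm n hn => ?_⟩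
    have h1 : IsAdjoint (u m - u n) (v m - v n) := by
      have h2 := (hv m).add ((hv n).smul (-1))
      simpa [sub_eq_add_neg] using h2
    rw [dist_eq_norm, ← h1.norm_eq, ← dist_eq_norm]
    exact hN m hm n hn
  obtain ⟨S, hS⟩ := cauchySeq_tendsto_of_complete hc
  refine ⟨S, fun x y => ?_⟩
  have h1 : Tendsto (fun n => inner P (u n x) y) atTop (𝓝 (inner P (T x) y)) := by
    have hx : Tendsto (fun n => u n x) atTop (𝓝 (T x)) :=
      ((ContinuousLinearMap.apply ℂ _ x).continuous.tendsto T).comp hlim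
    exact ((continuous_id.hilbertModule_inner continuous_const).tendsto (T x)).comp hx
  have h2 : Tendsto (fun n => inner P x (v n y)) atTop (𝓝 (inner P x (S y))) := by
    have hy : Tendsto (fun n => v n y) atTop (𝓝 (S y)) :=
      ((ContinuousLinearMap.apply ℂ _ y).continuous.tendsto S).comp hS
    exact ((continuous_const.hilbertModule_inner continuous_id).tendsto (S y)).comp hy
  refine tendsto_nhds_unique h1 (h2.congr fun n => ?_)
  exact (hv n x y).symm

instance : CompleteSpace (adjointable E) := isClosed_adjointable.completeSpace_coe

instance : CStarAlgebra (adjointable E) where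

end adjointable

variable (E : ConditionalExpectation P)

/-- The extension to `ℰ_E` of a linear map on `A` that is bounded for `‖E(x⋆ x)‖^{1/2}`. -/
def extendBounded (f : A →ₗ[ℂ] A) (C : ℝ) (hC : 0 ≤ C)
    (hf : ∀ x, ‖E (star (f x) * f x)‖ ≤ C ^ 2 * ‖E (star x * x)‖) :
    HilbertModule E →L[ℂ] HilbertModule E :=
  (LinearMap.mkContinuous (E := PreModule E) (F := PreModule E)
    ((PreModule.of E).toLinearMap ∘ₗ f ∘ₗ (PreModule.of E).symm.toLinearMap) C fun x => by
      refine abs_le_of_sq_le_sq' ?_ (by positivity) |>.2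
      rw [mul_pow, PreModule.norm_sq, PreModule.norm_sq]
      exact hf ((PreModule.of E).symm x)).completion

lemma extendBounded_eta (f : A →ₗ[ℂ] A) (C : ℝ) (hC : 0 ≤ C)
    (hf : ∀ x, ‖E (star (f x) * f x)‖ ≤ C ^ 2 * ‖E (star x * x)‖) (x : A) :
    extendBounded E f C hC hf (HilbertModule.eta E x) = HilbertModule.eta E (f x) :=
  ContinuousLinearMap.completion_apply_coe _ _

variable {E} in
lemma isAdjoint_of_eta {T S : HilbertModule E →L[ℂ] HilbertModule E}
    (h : ∀ a b : A, inner P (T (HilbertModule.eta E a)) (HilbertModule.eta E b) =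
      inner P (HilbertModule.eta E a) (S (HilbertModule.eta E b))) : IsAdjoint T S := fun x y =>
  HilbertModule.denseRange_eta.induction_on₂ (p := fun x y : HilbertModule E =>
    inner P (T x) y = inner P x (S y)) (isClosed_eq
      ((T.continuous.comp continuous_fst).hilbertModule_inner continuous_snd)
      (continuous_fst.hilbertModule_inner (S.continuous.comp continuous_snd))) h x y

namespace adjointable

variable {E} in
lemma ext_eta {T S : adjointable E}
    (h : ∀ a : A, T.1 (HilbertModule.eta E a) = S.1 (HilbertModule.eta E a)) : T = S :=
  Subtype.ext <| ContinuousLinearMap.ext fun x =>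
    HilbertModule.denseRange_eta.induction_on (p := fun x => T.1 x = S.1 x) x
      (isClosed_eq T.1.continuous S.1.continuous) h

/-- Left multiplication by `a` on `ℰ_E`. -/
def lmulCLM (a : A) : HilbertModule E →L[ℂ] HilbertModule E :=
  extendBounded E (LinearMap.mulLeft ℂ a) ‖a‖ (norm_nonneg a) (E.norm_map_star_mul_le a)

lemma lmulCLM_eta (a x : A) :
    lmulCLM E a (HilbertModule.eta E x) = HilbertModule.eta E (a * x) :=
  extendBounded_eta E _ _ _ _ x

lemma isAdjoint_lmulCLM (a : A) : IsAdjoint (lmulCLM E a) (lmulCLM E (star a)) :=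
  isAdjoint_of_eta fun x y => by
    rw [lmulCLM_eta, lmulCLM_eta, HilbertModule.inner_eta, HilbertModule.inner_eta, star_mul,
      mul_assoc]

/-- Left multiplication by `a`, as an adjointable operator. -/
def lmulAux (a : A) : adjointable E := ⟨lmulCLM E a, _, isAdjoint_lmulCLM E a⟩

lemma star_lmulAux (a : A) : star (lmulAux E a) = lmulAux E (star a) :=
  star_eq (isAdjoint_lmulCLM E a)

/-- The `⋆`-homomorphism `λ : A → ℒ(ℰ_E)`, `λ(a) η_E(x) = η_E(a x)`. -/
def lmul : A →⋆ₐ[ℂ] adjointable E where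
  toFun := lmulAux E
  map_one' := ext_eta fun x => by
    show lmulCLM E 1 _ = HilbertModule.eta E x
    rw [lmulCLM_eta, one_mul]
  map_mul' a b := ext_eta fun x => by
    show lmulCLM E (a * b) _ = lmulCLM E a (lmulCLM E b _)
    rw [lmulCLM_eta, lmulCLM_eta, lmulCLM_eta, mul_assoc]
  map_zero' := ext_eta fun x => by
    show lmulCLM E 0 _ = 0
    rw [lmulCLM_eta, zero_mul, map_zero]
  map_add' a b := ext_eta fun x => by
    show lmulCLM E (a + b) _ = lmulCLM E a _ + lmulCLM E b _
    rw [lmulCLM_eta, lmulCLM_eta, lmulCLM_eta, add_mul, map_add]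
  commutes' c := by
    refine ext_eta fun x => ?_
    have h1 : (algebraMap ℂ (adjointable E) c) = c • (1 : adjointable E) :=
      Algebra.algebraMap_eq_smul_one c
    have h2 : (algebraMap ℂ A c) = c • (1 : A) := Algebra.algebraMap_eq_smul_one c
    rw [h1, h2]
    show lmulCLM E (c • (1 : A)) _ = c • (HilbertModule.eta E x)
    rw [lmulCLM_eta, smul_mul_assoc, one_mul, map_smul]
  map_star' a := (star_lmulAux E a).symm

lemma lmul_eta (a x : A) :
    (lmul E a).1 (HilbertModule.eta E x) = HilbertModule.eta E (a * x) := lmulCLM_eta E a x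

/-- The map `η_E(x) ↦ η_E(E(x))`. -/
def jonesCLM : HilbertModule E →L[ℂ] HilbertModule E :=
  extendBounded E (P.toSubalgebra.val.toLinearMap ∘ₗ E.toLinearMap) 1 zero_le_one fun x => by
    rw [one_pow, one_mul]
    show ‖E (star (E x : A) * (E x : A))‖ ≤ ‖E (star x * x)‖
    have h1 : E (star (E x : A) * (E x : A)) = star (E x) * E x := by
      rw [E.map_mul_coe, ← StarMemClass.coe_star, E.map_coe]
    have h2 : ‖E x‖ ^ 2 ≤ ‖E 1‖ * ‖E (star x * x)‖ := by
      simpa using E.norm_map_star_mul_sq_le 1 x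
    have h3 : E 1 = 1 := E.map_coe 1
    rw [h1, CStarRing.norm_star_mul_self, ← sq]
    refine h2.trans (mul_le_of_le_one_left (norm_nonneg _) ?_)
    rw [h3]
    rcases subsingleton_or_nontrivial P with h | h
    · rw [Subsingleton.elim (1 : P) 0, norm_zero]; exact zero_le_one
    · exact CStarRing.norm_one.le

lemma jonesCLM_eta (x : A) : jonesCLM E (HilbertModule.eta E x) = HilbertModule.eta E (E x : A) :=
  extendBounded_eta E _ _ _ _ x

lemma isAdjoint_jonesCLM : IsAdjoint (jonesCLM E) (jonesCLM E) :=
  isAdjoint_of_eta fun x y => by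
    rw [jonesCLM_eta, jonesCLM_eta, HilbertModule.inner_eta, HilbertModule.inner_eta,
      ← StarMemClass.coe_star, E.map_coe_mul, E.map_mul_coe, E.map_star]

/-- The Jones projection `e_P ∈ ℒ(ℰ_E)`, `e_P η_E(x) = η_E(E(x))`. -/
def jones : adjointable E := ⟨jonesCLM E, _, isAdjoint_jonesCLM E⟩

lemma jones_eta (x : A) : (jones E).1 (HilbertModule.eta E x) = HilbertModule.eta E (E x : A) :=
  jonesCLM_eta E x

lemma star_jones : star (jones E) = jones E := star_eq (isAdjoint_jonesCLM E)

lemma jones_mul_lmul_mul_jones (a : A) :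
    jones E * lmul E a * jones E = lmul E (E a : A) * jones E := ext_eta fun x => by
  show (jones E).1 ((lmul E a).1 ((jones E).1 _)) = (lmul E _).1 ((jones E).1 _)
  rw [jones_eta, lmul_eta, lmul_eta, jones_eta, E.map_mul_coe]
  rfl

lemma norm_lmul_mul_jones (p : P) : ‖p‖ ≤ ‖lmul E (p : A) * jones E‖ := by
  have h1 : (lmul E (p : A) * jones E).1 (HilbertModule.eta E 1) = HilbertModule.eta E (p : A) := by
    show (lmul E _).1 ((jones E).1 _) = _
    have h3 : E 1 = 1 := E.map_coe 1
    rw [jones_eta, lmul_eta, h3]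
    simp
  have h2 : ∀ q : P, ‖HilbertModule.eta E (q : A)‖ = ‖q‖ := fun q => by
    have : ‖HilbertModule.eta E (q : A)‖ ^ 2 = ‖q‖ ^ 2 := by
      rw [HilbertModule.norm_eta_sq, E.map_mul_coe, ← StarMemClass.coe_star, E.map_coe,
        CStarRing.norm_star_mul_self, sq]
    exact (pow_left_inj₀ (norm_nonneg _) (norm_nonneg _) two_ne_zero).1 this
  have h3 := (lmul E (p : A) * jones E).1.le_opNorm (HilbertModule.eta E 1)
  rw [h1, h2] at h3
  refine h3.trans (mul_le_of_le_one_right (norm_nonneg _) ?_)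
  rw [show (1 : A) = ((1 : P) : A) from rfl, h2]
  rcases subsingleton_or_nontrivial P with h | h
  · rw [Subsingleton.elim (1 : P) 0, norm_zero]; exact zero_le_one
  · exact CStarRing.norm_one.le

end adjointable

end AdjointableOperators

section BasicConstruction

open adjointable

variable {A : Type*} [CStarAlgebra A] [PartialOrder A] [StarOrderedRing A]
  {P : StarSubalgebra ℂ A} [IsClosed (P : Set A)] (E : ConditionalExpectation P)

/-- `T` is a finite sum `∑ λ(x_i) e_P λ(y_i)`. -/
def IsJonesSum (T : adjointable E) : Prop :=
  ∃ (n : ℕ) (x y : Fin n → A), T = ∑ i, lmul E (x i) * jones E * lmul E (y i)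

namespace IsJonesSum

variable {E}

lemma of_fintype {ι : Type*} [Fintype ι] (x y : ι → A) :
    IsJonesSum E (∑ i, lmul E (x i) * jones E * lmul E (y i)) :=
  ⟨_, x ∘ (Fintype.equivFin ι).symm, y ∘ (Fintype.equivFin ι).symm,
    ((Fintype.equivFin ι).symm.sum_comp
      (fun i => lmul E (x i) * jones E * lmul E (y i))).symm⟩

lemma add {T S : adjointable E} (hT : IsJonesSum E T) (hS : IsJonesSum E S) :
    IsJonesSum E (T + S) := by
  obtain ⟨n, x, y, rfl⟩ := hT
  obtain ⟨m, x', y', rfl⟩ := hS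
  simpa using of_fintype (E := E) (Sum.elim x x') (Sum.elim y y')

lemma zero : IsJonesSum E 0 := ⟨0, Fin.elim0, Fin.elim0, by simp⟩

lemma sum {ι : Type*} (s : Finset ι) {T : ι → adjointable E} (hT : ∀ i, IsJonesSum E (T i)) :
    IsJonesSum E (∑ i ∈ s, T i) := by
  classical
  induction s using Finset.induction_on with
  | empty => simpa using zero
  | insert i s hi ih => rw [Finset.sum_insert hi]; exact (hT i).add ih

lemma single (x y : A) : IsJonesSum E (lmul E x * jones E * lmul E y) :=
  ⟨1, fun _ => x, fun _ => y, by simp⟩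

lemma mul {T S : adjointable E} (hT : IsJonesSum E T) (hS : IsJonesSum E S) :
    IsJonesSum E (T * S) := by
  obtain ⟨n, x, y, rfl⟩ := hT
  obtain ⟨m, x', y', rfl⟩ := hS
  rw [Finset.sum_mul]
  refine sum _ fun i => ?_
  rw [Finset.mul_sum]
  refine sum _ fun j => ?_
  have h : lmul E (x i) * jones E * lmul E (y i) * (lmul E (x' j) * jones E * lmul E (y' j)) =
      lmul E (x i * (E (y i * x' j) : A)) * jones E * lmul E (y' j) := by
    calc _ = lmul E (x i) * (jones E * (lmul E (y i) * lmul E (x' j)) * jones E) *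
          lmul E (y' j) := by simp only [mul_assoc]
      _ = _ := by
        rw [← map_mul, jones_mul_lmul_mul_jones, map_mul (lmul E)]
        simp only [mul_assoc]
  rw [h]
  exact single _ _

lemma star {T : adjointable E} (hT : IsJonesSum E T) : IsJonesSum E (star T) := by
  obtain ⟨n, x, y, rfl⟩ := hT
  rw [star_sum]
  refine sum _ fun i => ?_
  rw [star_mul, star_mul, star_jones, ← map_star, ← map_star, ← mul_assoc]
  exact single _ _

lemma sum_quasiBasis {n : ℕ} {u v : Fin n → A} (h : E.IsQuasiBasis u v) :
    ∑ i, lmul E (u i) * jones E * lmul E (v i) = 1 := ext_eta fun x => by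
  have h1 : (∑ i, lmul E (u i) * jones E * lmul E (v i) : adjointable E).1 =
      ∑ i, (lmul E (u i)).1 * (jones E).1 * (lmul E (v i)).1 := by
    push_cast
    rfl
  rw [h1, _root_.sum_apply]
  show ∑ i, (lmul E (u i)).1 ((jones E).1 ((lmul E (v i)).1 _)) = HilbertModule.eta E x
  simp only [lmul_eta, jones_eta]
  rw [← map_sum, ← (h x).1]

variable [E.IsIndexFinite]

variable (E) in
lemma lmul_mem (a : A) : IsJonesSum E (lmul E a) := by
  obtain ⟨n, u, v, h⟩ := ConditionalExpectation.IsIndexFinite.exists_quasiBasis (E := E)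
  rw [← mul_one (lmul E a), ← sum_quasiBasis h, Finset.mul_sum]
  refine sum _ fun i => ?_
  rw [← mul_assoc, ← mul_assoc, ← map_mul]
  exact single _ _

variable (E) in
lemma isClosed : IsClosed {T : adjointable E | IsJonesSum E T} := by
  obtain ⟨n, u, v, h⟩ := ConditionalExpectation.IsIndexFinite.exists_quasiBasis (E := E)
  let κ : P →+ adjointable E :=
    { toFun := fun p => lmul E (p : A) * jones E
      map_zero' := by simp
      map_add' := fun p q => by
        rw [AddMemClass.coe_add, map_add, add_mul] }
  have hlip : ∀ p : P, ‖κ p‖ ≤ ‖jones E‖ * ‖p‖ := fun p => by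
    have h1 : ‖lmul E (p : A)‖ ≤ ‖p‖ := by
      exact NonUnitalStarAlgHom.norm_apply_le (lmul E) (p : A)
    rw [mul_comm]
    exact (norm_mul_le _ _).trans (by gcongr)
  have hcl : IsClosed (Set.range κ) := by
    have h1 : AntilipschitzWith 1 κ := AddMonoidHomClass.antilipschitz_of_bound κ fun p => by
      rw [NNReal.coe_one, one_mul]
      exact norm_lmul_mul_jones E p
    have h2 : UniformContinuous κ :=
      (AddMonoidHomClass.lipschitz_of_bound κ _ hlip).uniformContinuous
    exact h1.isClosed_range h2
  refine isClosed_of_closure_subset fun T hT => ?_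
  have hmem : ∀ i j, jones E * lmul E (v i) * T * (lmul E (u j) * jones E) ∈ Set.range κ := by
    intro i j
    rw [← hcl.closure_eq]
    refine map_mem_closure
      (f := fun S => jones E * lmul E (v i) * S * (lmul E (u j) * jones E)) (by fun_prop) hT ?_
    rintro S ⟨m, x, y, rfl⟩
    refine ⟨∑ k, E (v i * x k) * E (y k * u j), ?_⟩
    beta_reduce
    rw [map_sum κ, Finset.mul_sum, Finset.sum_mul]
    refine Finset.sum_congr rfl fun k _ => ?_
    show lmul E ((E (v i * x k) * E (y k * u j) : P) : A) * jones E = _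
    calc _ = lmul E (E (v i * x k) : A) * (lmul E (E (y k * u j) : A) * jones E) := by
          rw [MulMemClass.coe_mul, map_mul, mul_assoc]
      _ = lmul E (E (v i * x k) : A) * jones E * lmul E (y k * u j) * jones E := by
          rw [← jones_mul_lmul_mul_jones]; simp only [mul_assoc]
      _ = _ := by
          rw [← jones_mul_lmul_mul_jones, map_mul, map_mul]; simp only [mul_assoc]
  have hT' : T = ∑ i, ∑ j, lmul E (u i) *
      (jones E * lmul E (v i) * T * (lmul E (u j) * jones E)) * lmul E (v j) := by
    calc T = (∑ i, lmul E (u i) * jones E * lmul E (v i)) * T *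
          (∑ j, lmul E (u j) * jones E * lmul E (v j)) := by
          rw [sum_quasiBasis h, one_mul, mul_one]
      _ = _ := by
          rw [Finset.sum_mul, Finset.sum_mul]
          refine Finset.sum_congr rfl fun i _ => ?_
          rw [Finset.mul_sum]
          refine Finset.sum_congr rfl fun j _ => ?_
          simp only [mul_assoc]
  rw [hT']
  refine sum _ fun i => sum _ fun j => ?_
  obtain ⟨p, hp⟩ := hmem i j
  rw [← hp]
  show IsJonesSum E (lmul E (u i) * (lmul E (p : A) * jones E) * lmul E (v j))
  rw [← mul_assoc, ← map_mul]
  exact single _ _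

end IsJonesSum

variable [E.IsIndexFinite]

/-- The C⋆-basic construction `C⋆⟨A, e_P⟩ = {∑ λ(x_i) e_P λ(y_i)} ⊆ ℒ(ℰ_E)` of a conditional
expectation of index-finite type. -/
def basicConstruction : StarSubalgebra ℂ (adjointable E) where
  carrier := {T | ∃ (n : ℕ) (x y : Fin n → A), T = ∑ i, lmul E (x i) * jones E * lmul E (y i)}
  mul_mem' hT hS := IsJonesSum.mul hT hS
  add_mem' hT hS := IsJonesSum.add hT hS
  star_mem' hT := IsJonesSum.star hT
  algebraMap_mem' c := by
    rw [← AlgHomClass.commutes (lmul E) c]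
    exact IsJonesSum.lmul_mem E _

namespace basicConstruction

/-- The norm closedness of the basic construction; it makes it a C⋆-algebra. -/
instance : IsClosed (basicConstruction E : Set (adjointable E)) := IsJonesSum.isClosed E

/-- The order given by the cone of positive elements. -/
instance : PartialOrder (basicConstruction E) := CStarAlgebra.spectralOrder _

instance : StarOrderedRing (basicConstruction E) := CStarAlgebra.spectralOrderedRing _

/-- The embedding `λ` of `A` into the basic construction. -/
def incl : A →⋆ₐ[ℂ] basicConstruction E :=
  (lmul E).codRestrict (basicConstruction E) (IsJonesSum.lmul_mem E)

end basicConstruction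

end BasicConstruction

section Representability

/-- Two positive elements (of a C⋆-algebra) are orthogonal if `a b = b a = 0`. -/
def Orthogonal {A : Type*} [CStarAlgebra A] (a b : A) : Prop := a * b = 0 ∧ b * a = 0

/-- The completely positive map `φ` has order zero. -/
def HasOrderZero {A B : Type*} [CStarAlgebra A] [PartialOrder A] [StarOrderedRing A]
    [CStarAlgebra B] [PartialOrder B] [StarOrderedRing B] (φ : A →CP B) : Prop :=
  ∀ a b : A, 0 ≤ a → 0 ≤ b → Orthogonal a b → Orthogonal (φ a) (φ b)

/-- Cuntz subequivalence `a ≲ b` (of positive elements): there is a sequence `(x_n)` with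
`‖x_n b x_n⋆ - a‖ → 0`. -/
def CuntzSubequivalent {A : Type*} [CStarAlgebra A] (a b : A) : Prop :=
  ∃ x : ℕ → A, Tendsto (fun n => ‖x n * b * star (x n) - a‖) atTop (𝓝 0)

variable {A : Type*} [CStarAlgebra A] [PartialOrder A] [StarOrderedRing A]
  {P : StarSubalgebra ℂ A} [IsClosed (P : Set A)]

open SeqAlgebra in
/-- The data `(e, r, {u_i})` in the definition of the generalized tracial approximate
representability of `E`, for the element `z` of `A_∞`. -/
structure IsApproxRepresentation (E : ConditionalExpectation P) (z e r : SeqAlgebra A) {n : ℕ}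
    (u : Fin n → A) : Prop where
  /-- `e` is a positive contraction. -/
  e_nonneg : 0 ≤ e
  e_norm_le : ‖e‖ ≤ 1
  /-- `e ∈ P_∞`. -/
  e_mem : e ∈ ofSubalgebra P
  /-- `e ∈ P'`. -/
  e_comm : ∀ p ∈ P, e * const p = const p * e
  /-- `r` is a positive contraction. -/
  r_nonneg : 0 ≤ r
  r_norm_le : ‖r‖ ≤ 1
  /-- `r ∈ A'`. -/
  r_comm : ∀ a : A, r * const a = const a * r
  /-- `e^{1/2} x e^{1/2} = E(x) e` for all `x ∈ A`. -/
  e_conj : ∀ x : A, e ^ (1 / 2 : ℝ) * const x * e ^ (1 / 2 : ℝ) = const (E x : A) * e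
  /-- `∑ u_i e u_i⋆ = r`. -/
  sum_eq : ∑ i, const (u i) * e * star (const (u i)) = r
  /-- `r e^{1/2} = e^{3/2} = e^{1/2} r`. -/
  r_mul : r * e ^ (1 / 2 : ℝ) = e ^ (3 / 2 : ℝ)
  mul_r : e ^ (1 / 2 : ℝ) * r = e ^ (3 / 2 : ℝ)
  /-- `1 - r ≲ z` in `A_∞`. -/
  one_sub_r : CuntzSubequivalent (1 - r) z
  /-- The map `P ∋ x ↦ x e` is injective. -/
  injective : Function.Injective fun x : P => const (x : A) * e

/-- `E` has the generalized tracial approximate representability. -/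
def ConditionalExpectation.HasGenTracialApproxRep (E : ConditionalExpectation P) : Prop :=
  ∀ z : SeqAlgebra A, 0 ≤ z → z ≠ 0 →
    ∃ (e r : SeqAlgebra A) (n : ℕ) (u : Fin n → A), IsApproxRepresentation E z e r u

end Representability

end CStarInclusion

end

open CStarInclusion

/-!
Let `(e, r, (u_i))` be an approximate representation of `E` and put `f = e^{1/2}`, which commutes
with `P`. The relation `f x f = E(x) e` says that `e` behaves like a (non-idempotent) Jones
projection, and `r f = f ^ 3` says that `r` acts on it as multiplication by `e`.

*Quasi-basis.* For `x ∈ A`, sandwiching gives `x f ^ 3 = x r f = r x f = ∑ u_i f (f u_i⋆ x f) =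
∑ u_i E(u_i⋆ x) f ^ 3`. So `y = x - ∑ u_i E(u_i⋆ x)` satisfies `y f ^ 3 = 0`, hence `y f = 0` because
`f` is positive, hence `E(y⋆ y) e = f y⋆ y f = 0`. As `p ↦ p e` is injective on `P` and `E` is
faithful, `y = 0` (`IsApproxRepresentation.isQuasiBasis`).

*The order zero map.* The map is `ψ(∑ λ(x_i) e_P λ(y_i)) = ∑ x_i e y_i`. It is well defined because
the quasi-basis recovers an operator `T` of the basic construction from its matrix coefficients
`⟨η(u_i), T η(u_j)⟩ ∈ P` (`amplify`, `amplify_jonesElem`). If `φ` is the same map with `f` in place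
of `e`, then `ψ(S⋆ T) = φ(S)⋆ φ(T)`, whence complete positivity; and
`ψ(S) ψ(T) = r ψ(S T)`, whence order zero. Since `∑ λ(u_i) e_P λ(u_i⋆) = 1`, one has `ψ(1) = r`, and
`f a⋆ ψ(T) b f = ⟨η(a), T η(b)⟩ e ^ 2` for `a, b ∈ A` gives injectivity, once more because `P ∋ p`
is determined by `p e`.
-/

noncomputable section

namespace CStarInclusion

open adjointable SeqAlgebra

/-- By the C⋆-identity, a self-adjoint factor `f` occurring twice may be cancelled once. -/
lemma mul_eq_zero_of_mul_mul_self_eq_zero {B : Type*} [CStarAlgebra B] {f y : B}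
    (hf : IsSelfAdjoint f) (h : y * (f * f) = 0) : y * f = 0 := by
  rw [← CStarRing.mul_star_self_eq_zero_iff, star_mul, hf.star_eq,
    show y * f * (f * star y) = y * (f * f) * star y by simp only [mul_assoc], h, zero_mul]

/-- A linear map that factors as `ψ(S⋆ T) = φ(S)⋆ φ(T)` is completely positive. -/
lemma map_cstarMatrix_nonneg_of_factor {B C : Type*} [CStarAlgebra B] [PartialOrder B]
    [StarOrderedRing B] [CStarAlgebra C] [PartialOrder C] [StarOrderedRing C] {ψ φ : B →ₗ[ℂ] C}
    (h : ∀ S T, ψ (star S * T) = star (φ S) * φ T) (k : ℕ) {M : CStarMatrix (Fin k) (Fin k) B}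
    (hM : 0 ≤ M) : 0 ≤ M.map ψ := by
  have hadd : ∀ M N : CStarMatrix (Fin k) (Fin k) B, (M + N).map ψ = M.map ψ + N.map ψ :=
    fun M N => by ext i j; exact map_add ψ _ _
  have hzero : (0 : CStarMatrix (Fin k) (Fin k) B).map ψ = 0 := by ext i j; exact map_zero ψ
  rw [StarOrderedRing.nonneg_iff] at hM
  induction hM using AddSubmonoid.closure_induction with
  | zero => rw [hzero]
  | add M N _ _ hM hN => rw [hadd]; exact add_nonneg hM hN
  | mem M hM =>
  obtain ⟨N, rfl⟩ := hM
  show 0 ≤ (star N * N).map ψ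
  have h1 : (star N * N).map ψ = star (N.map φ) * N.map φ := by
    ext i j
    simp only [CStarMatrix.map_apply, CStarMatrix.mul_apply, CStarMatrix.star_apply, map_sum, h]
  rw [h1]
  exact star_mul_self_nonneg _

/-- It suffices to check `ψ(S⋆ T) = φ(S)⋆ φ(T)` on additive generators. Both this lemma and the next
one are stated for abstract C⋆-algebras because rewriting inside `basicConstruction E` is slow: its
operations are inherited through two subalgebras of the operators on a completion. -/
lemma map_star_mul_of_generators {X C D : Type*} [CStarAlgebra C] [CStarAlgebra D]
    {ψ φ : C →ₗ[ℂ] D} {J : X → X → C}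
    (hJ : ∀ T, ∃ (n : ℕ) (x y : Fin n → X), T = ∑ i, J (x i) (y i))
    (h : ∀ x y x' y', ψ (star (J x y) * J x' y') = star (φ (J x y)) * φ (J x' y')) (S T : C) :
    ψ (star S * T) = star (φ S) * φ T := by
  obtain ⟨k, x, y, rfl⟩ := hJ S
  obtain ⟨l, x', y', rfl⟩ := hJ T
  simp only [star_sum, Finset.sum_mul_sum, map_sum, h]

/-- It suffices to check `ψ(S) ψ(T) = r ψ(S T)` on additive generators. -/
lemma map_mul_map_of_generators {X C D : Type*} [CStarAlgebra C] [CStarAlgebra D]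
    {ψ : C →ₗ[ℂ] D} {r : D} {J : X → X → C}
    (hJ : ∀ T, ∃ (n : ℕ) (x y : Fin n → X), T = ∑ i, J (x i) (y i))
    (h : ∀ x y x' y', ψ (J x y) * ψ (J x' y') = r * ψ (J x y * J x' y')) (S T : C) :
    ψ S * ψ T = r * ψ (S * T) := by
  obtain ⟨k, x, y, rfl⟩ := hJ S
  obtain ⟨l, x', y', rfl⟩ := hJ T
  simp only [Finset.sum_mul_sum, map_sum]
  simp only [h, Finset.mul_sum]

variable {A : Type*} [CStarAlgebra A] [PartialOrder A] [StarOrderedRing A]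
  {P : StarSubalgebra ℂ A} [IsClosed (P : Set A)]

/-! ### The quasi-basis -/

namespace IsApproxRepresentation

variable {E : ConditionalExpectation P} {z e r : SeqAlgebra A} {n : ℕ} {u : Fin n → A}

lemma rpow_half_isSelfAdjoint (_h : IsApproxRepresentation E z e r u) :
    IsSelfAdjoint (e ^ (1 / 2 : ℝ)) :=
  CFC.rpow_nonneg.isSelfAdjoint

lemma rpow_half_mul_self (h : IsApproxRepresentation E z e r u) :
    e ^ (1 / 2 : ℝ) * e ^ (1 / 2 : ℝ) = e := by
  rw [← CFC.sqrt_eq_rpow]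
  exact CFC.sqrt_mul_sqrt_self e h.e_nonneg

lemma rpow_three_halves (h : IsApproxRepresentation E z e r u) :
    e ^ (3 / 2 : ℝ) = e ^ (1 / 2 : ℝ) * e := by
  have h1 := CFC.rpow_rpow_of_exponent_nonneg e (1 / 2) 3 (by norm_num) (by norm_num) h.e_nonneg
  have h2 := CFC.rpow_natCast (e ^ (1 / 2 : ℝ)) 3 CFC.rpow_nonneg
  rw [show (1 / 2 * 3 : ℝ) = 3 / 2 by norm_num] at h1
  rw [← h1, show (3 : ℝ) = ((3 : ℕ) : ℝ) by norm_num, h2, pow_succ', sq, h.rpow_half_mul_self]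

lemma r_mul_e (h : IsApproxRepresentation E z e r u) : r * e = e * e := by
  have h1 := h.r_mul
  calc r * e = r * e ^ (1 / 2 : ℝ) * e ^ (1 / 2 : ℝ) := by rw [mul_assoc, h.rpow_half_mul_self]
    _ = e ^ (1 / 2 : ℝ) * (e ^ (1 / 2 : ℝ) * e ^ (1 / 2 : ℝ)) * e ^ (1 / 2 : ℝ) := by
      rw [h1, h.rpow_three_halves, h.rpow_half_mul_self]
    _ = e * e := by
      rw [mul_assoc, mul_assoc, ← mul_assoc, h.rpow_half_mul_self]

lemma rpow_half_comm (h : IsApproxRepresentation E z e r u) {p : A} (hp : p ∈ P) :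
    e ^ (1 / 2 : ℝ) * const p = const p * e ^ (1 / 2 : ℝ) :=
  Commute.cfc_nnreal (h.e_comm p hp) _

lemma eq_zero_of_mul_e (h : IsApproxRepresentation E z e r u) {p : P}
    (hp : const (p : A) * e = 0) : p = 0 :=
  h.injective (by simpa using hp)

/-- One half of the quasi-basis identity; the other half is its adjoint. -/
lemma eq_sum (h : IsApproxRepresentation E z e r u) [E.IsIndexFinite] (x : A) :
    x = ∑ k, u k * (E (star (u k) * x) : A) := by
  set f := e ^ (1 / 2 : ℝ) with hf
  have hff : f * f = e := h.rpow_half_mul_self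
  have hfs : IsSelfAdjoint f := h.rpow_half_isSelfAdjoint
  set y := x - ∑ k, u k * (E (star (u k) * x) : A) with hy
  have h1 : const x * (f * e) = ∑ k, const (u k) * const (E (star (u k) * x) : A) * (f * e) := by
    calc const x * (f * e) = r * const x * f := by
          rw [← h.rpow_three_halves, ← h.r_mul, ← mul_assoc, ← h.r_comm]
      _ = ∑ k, const (u k) * e * star (const (u k)) * const x * f := by
          rw [← h.sum_eq, Finset.sum_mul, Finset.sum_mul]
      _ = _ := Finset.sum_congr rfl fun k _ => by
          have h2 : f * const (star (u k) * x) * f = const (E (star (u k) * x) : A) * e :=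
            h.e_conj _
          have h3 : f * const (E (star (u k) * x) : A) = const (E (star (u k) * x) : A) * f :=
            h.rpow_half_comm (E (star (u k) * x)).2
          calc _ = const (u k) * (f * (f * const (star (u k) * x) * f)) := by
                rw [← hff, map_mul, map_star]; simp only [mul_assoc]
            _ = _ := by rw [h2, ← mul_assoc f, h3]; simp only [mul_assoc]
  have h2 : const y * (f * e) = 0 := by
    rw [hy, map_sub, map_sum, sub_mul, h1, Finset.sum_mul, sub_eq_zero]
    simp only [map_mul]
  -- Cancel `f ^ 4` down to `f ^ 2`, and then to `f`.
  have h3 : const y * f = 0 := by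
    have h4 : const y * f * (f * f) = 0 := by rw [hff, mul_assoc, h2]
    have h5 := mul_eq_zero_of_mul_mul_self_eq_zero hfs h4
    rw [mul_assoc] at h5
    exact mul_eq_zero_of_mul_mul_self_eq_zero hfs h5
  have h4 : E (star y * y) = 0 := h.eq_zero_of_mul_e <| by
    rw [← h.e_conj, map_mul, mul_assoc, mul_assoc, ← hf, h3, mul_zero, mul_zero]
  exact sub_eq_zero.1 (E.faithful h4)

theorem isQuasiBasis (h : IsApproxRepresentation E z e r u) [E.IsIndexFinite] :
    E.IsQuasiBasis u (fun i => star (u i)) := fun x => by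
  refine ⟨h.eq_sum x, ?_⟩
  have h1 := congrArg star (h.eq_sum (star x))
  rw [star_star, star_sum] at h1
  refine h1.trans (Finset.sum_congr rfl fun k _ => ?_)
  rw [star_mul, ← StarMemClass.coe_star, ← E.map_star, star_mul, star_star, star_star]

end IsApproxRepresentation

/-! ### Linear maps out of the basic construction -/

variable {E : ConditionalExpectation P} [E.IsIndexFinite]

variable (E) in
/-- The element `λ(x) e_P λ(y)` of the basic construction. -/
def jonesElem (x y : A) : basicConstruction E :=
  ⟨lmul E x * jones E * lmul E y, IsJonesSum.single x y⟩

lemma exists_eq_sum_jonesElem (T : basicConstruction E) :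
    ∃ (n : ℕ) (x y : Fin n → A), T = ∑ i, jonesElem E (x i) (y i) := by
  obtain ⟨n, x, y, h⟩ := T.2
  refine ⟨n, x, y, Subtype.ext ?_⟩
  rw [h]
  push_cast
  rfl

lemma star_jonesElem (x y : A) : star (jonesElem E x y) = jonesElem E (star y) (star x) := by
  refine Subtype.ext ?_
  show star (lmul E x * jones E * lmul E y) = lmul E (star y) * jones E * lmul E (star x)
  rw [star_mul, star_mul, star_jones, map_star, map_star, mul_assoc]

lemma jonesElem_mul_jonesElem (x y x' y' : A) :
    jonesElem E x y * jonesElem E x' y' = jonesElem E (x * (E (y * x') : A)) y' := by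
  refine Subtype.ext ?_
  show lmul E x * jones E * lmul E y * (lmul E x' * jones E * lmul E y') =
    lmul E (x * (E (y * x') : A)) * jones E * lmul E y'
  calc _ = lmul E x * (jones E * (lmul E y * lmul E x') * jones E) * lmul E y' := by
        simp only [mul_assoc]
    _ = _ := by
        rw [← map_mul, jones_mul_lmul_mul_jones, map_mul (lmul E)]
        simp only [mul_assoc]

lemma star_jonesElem_mul_jonesElem (x y x' y' : A) :
    star (jonesElem E x y) * jonesElem E x' y' =
      jonesElem E (star y * (E (star x * x') : A)) y' := by
  rw [star_jonesElem, jonesElem_mul_jonesElem]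

lemma incl_mul_jonesElem (a x y : A) :
    basicConstruction.incl E a * jonesElem E x y = jonesElem E (a * x) y := by
  refine Subtype.ext ?_
  show lmul E a * (lmul E x * jones E * lmul E y) = lmul E (a * x) * jones E * lmul E y
  rw [map_mul]
  simp only [mul_assoc]

lemma sum_jonesElem {n : ℕ} {u v : Fin n → A} (h : E.IsQuasiBasis u v) :
    ∑ i, jonesElem E (u i) (v i) = 1 := by
  refine Subtype.ext ?_
  push_cast
  exact IsJonesSum.sum_quasiBasis h

variable (E) in
/-- The matrix coefficient `⟨η(a⋆), T η(b)⟩ ∈ P` of an operator `T` of the basic construction. -/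
def coeff (a b : A) : basicConstruction E →ₗ[ℂ] P where
  toFun T := inner P (HilbertModule.eta E (star a)) (T.1.1 (HilbertModule.eta E b))
  map_add' _ _ := HilbertModule.inner_add_right _ _ _
  map_smul' _ _ := HilbertModule.inner_smul_right _ _ _

lemma coeff_jonesElem (a b x y : A) :
    coeff E a b (jonesElem E x y) = E (a * x) * E (y * b) := by
  show inner P (HilbertModule.eta E (star a))
    ((lmul E x).1 ((jones E).1 ((lmul E y).1 (HilbertModule.eta E b)))) = _
  rw [lmul_eta, jones_eta, lmul_eta, HilbertModule.inner_eta, star_star, ← mul_assoc, E.map_mul_coe]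

variable (E) in
/-- For a quasi-basis `{(u_i, u_i⋆)}` and `g ∈ A_∞ ∩ P'`, the map
`∑ λ(x_i) e_P λ(y_i) ↦ ∑ x_i g y_i` (see `amplify_jonesElem`). It is defined as
`T ↦ ∑ u_i ⟨η(u_i), T η(u_j)⟩ g u_j⋆`, which makes sense for all `u` and `g` and depends on no
expression of `T` as a sum. -/
def amplify {n : ℕ} (u : Fin n → A) (g : SeqAlgebra A) : basicConstruction E →ₗ[ℂ] SeqAlgebra A where
  toFun T := ∑ i, ∑ j, const (u i * (coeff E (star (u i)) (u j) T : A)) * g * const (star (u j))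
  map_add' S T := by
    simp only [map_add, AddMemClass.coe_add, mul_add, add_mul, Finset.sum_add_distrib]
  map_smul' c T := by
    simp only [map_smul, SetLike.val_smul, mul_smul_comm, smul_mul_assoc, Finset.smul_sum,
      RingHom.id_apply]

lemma amplify_jonesElem {n : ℕ} {u : Fin n → A} (hu : E.IsQuasiBasis u fun i => star (u i))
    {g : SeqAlgebra A} (hg : ∀ p ∈ P, g * const p = const p * g) (x y : A) :
    amplify E u g (jonesElem E x y) = const x * g * const y := by
  show ∑ i, ∑ j, const (u i * (coeff E (star (u i)) (u j) (jonesElem E x y) : A)) * g *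
    const (star (u j)) = _
  calc _ = ∑ i, ∑ j, const (u i * (E (star (u i) * x) : A)) * g *
        const ((E (y * u j) : A) * star (u j)) :=
        Finset.sum_congr rfl fun i _ => Finset.sum_congr rfl fun j _ => by
          rw [coeff_jonesElem, MulMemClass.coe_mul, ← mul_assoc (u i), map_mul const (u i * _),
            mul_assoc (const (u i * _)), ← hg _ (E (y * u j)).2, map_mul const (E (y * u j) : A)]
          simp only [mul_assoc]
    _ = const (∑ i, u i * (E (star (u i) * x) : A)) * g *
        const (∑ j, (E (y * u j) : A) * star (u j)) := by
        rw [map_sum, map_sum, Finset.sum_mul, Finset.sum_mul]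
        exact Finset.sum_congr rfl fun i _ => by rw [Finset.mul_sum]
    _ = _ := by rw [← (hu x).1, ← (hu y).2]

/-! ### The order zero map of an approximate representation -/

namespace IsApproxRepresentation

variable {z e r : SeqAlgebra A} {n : ℕ} {u : Fin n → A}

lemma amplify_e (h : IsApproxRepresentation E z e r u) (x y : A) :
    amplify E u e (jonesElem E x y) = const x * e * const y :=
  amplify_jonesElem h.isQuasiBasis h.e_comm x y

lemma star_mul_conj (h : IsApproxRepresentation E z e r u) (x y x' y' : A) :
    star (const x * e ^ (1 / 2 : ℝ) * const y) * (const x' * e ^ (1 / 2 : ℝ) * const y') =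
      const (star y * (E (star x * x') : A)) * e * const y' := by
  rw [star_mul, star_mul, h.rpow_half_isSelfAdjoint.star_eq, ← map_star, ← map_star,
    map_mul const (star y), mul_assoc _ (const (E (star x * x') : A)) e, ← h.e_conj, map_mul]
  simp only [mul_assoc]

/-- `ψ(S⋆ T) = φ(S)⋆ φ(T)`, with `φ` built from `e^{1/2}` as `ψ` is from `e`: the Stinespring-type
factorization behind the complete positivity of `amplify E u e`. -/
lemma amplify_star_mul (h : IsApproxRepresentation E z e r u) (S T : basicConstruction E) :
    amplify E u e (star S * T) =
      star (amplify E u (e ^ (1 / 2 : ℝ)) S) * amplify E u (e ^ (1 / 2 : ℝ)) T := by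
  have hamp : ∀ x y : A, amplify E u (e ^ (1 / 2 : ℝ)) (jonesElem E x y) =
      const x * e ^ (1 / 2 : ℝ) * const y :=
    amplify_jonesElem h.isQuasiBasis fun p hp => h.rpow_half_comm hp
  refine map_star_mul_of_generators (C := basicConstruction E) (J := jonesElem E)
    exists_eq_sum_jonesElem (fun x y x' y' => ?_) S T
  have h1 := congrArg (amplify E u e) (star_jonesElem_mul_jonesElem (E := E) x y x' y')
  refine h1.trans ?_
  rw [h.amplify_e, hamp, hamp]
  exact (h.star_mul_conj x y x' y').symm

/-- Up to the factor `r`, the map `amplify E u e` is multiplicative, which gives order zero. -/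
lemma amplify_mul_amplify (h : IsApproxRepresentation E z e r u) (S T : basicConstruction E) :
    amplify E u e S * amplify E u e T = r * amplify E u e (S * T) := by
  refine map_mul_map_of_generators (C := basicConstruction E)
    (J := jonesElem E) exists_eq_sum_jonesElem (fun x y x' y' => ?_) S T
  rw [jonesElem_mul_jonesElem, h.amplify_e, h.amplify_e, h.amplify_e]
  set f := e ^ (1 / 2 : ℝ) with hf
  have hff : f * f = e := h.rpow_half_mul_self
  have h1 : f * const (y * x') * f = const (E (y * x') : A) * e := h.e_conj _
  have h2 : f * const (E (y * x') : A) = const (E (y * x') : A) * f :=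
    h.rpow_half_comm (E (y * x')).2
  have h3 : e * const y * (const x' * e) = const (E (y * x') : A) * (e * e) := by
    calc _ = f * (f * const (y * x') * f) * f := by
          rw [← hff, map_mul]; simp only [mul_assoc]
      _ = const (E (y * x') : A) * (f * (f * f) * f) := by
          rw [h1, ← hff, ← mul_assoc, h2]; simp only [mul_assoc]
      _ = _ := by rw [← hff]; simp only [mul_assoc]
  calc _ = const x * (e * const y * (const x' * e)) * const y' := by
        simp only [mul_assoc]
    _ = const (x * (E (y * x') : A)) * r * e * const y' := by
        rw [h3, ← h.r_mul_e, map_mul const x]; simp only [mul_assoc]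
    _ = _ := by rw [← h.r_comm]; simp only [mul_assoc]

/-- The values of `amplify E u e` determine the matrix coefficients, up to the factor `e ^ 2`. -/
lemma rpow_half_mul_amplify (h : IsApproxRepresentation E z e r u) (a b : A)
    (T : basicConstruction E) :
    e ^ (1 / 2 : ℝ) * const a * amplify E u e T * const b * e ^ (1 / 2 : ℝ) =
      const (coeff E a b T : A) * (e * e) := by
  set f := e ^ (1 / 2 : ℝ) with hf
  have hff : f * f = e := h.rpow_half_mul_self
  obtain ⟨k, x, y, rfl⟩ := exists_eq_sum_jonesElem T
  simp only [map_sum, h.amplify_e, coeff_jonesElem, AddSubmonoidClass.coe_finsetSum,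
    Finset.mul_sum, Finset.sum_mul]
  refine Finset.sum_congr rfl fun i _ => ?_
  have h1 : f * const (a * x i) * f = const (E (a * x i) : A) * e := h.e_conj _
  have h2 : f * const (y i * b) * f = const (E (y i * b) : A) * e := h.e_conj _
  calc _ = (f * const (a * x i) * f) * (f * const (y i * b) * f) := by
        rw [← hff, map_mul, map_mul]; simp only [mul_assoc]
    _ = const (E (a * x i) : A) * (e * const (E (y i * b) : A)) * e := by
        rw [h1, h2]; simp only [mul_assoc]
    _ = _ := by
        rw [h.e_comm _ (E (y i * b)).2, MulMemClass.coe_mul, map_mul const (E (a * x i) : A)]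
        simp only [mul_assoc]

lemma amplify_injective (h : IsApproxRepresentation E z e r u) :
    Function.Injective (amplify E u e) := by
  rw [injective_iff_map_eq_zero]
  intro T hT
  have hcoeff : ∀ a b : A, coeff E a b T = 0 := fun a b => by
    refine h.eq_zero_of_mul_e (mul_eq_zero_of_mul_mul_self_eq_zero h.e_nonneg.isSelfAdjoint ?_)
    rw [← h.rpow_half_mul_amplify, hT]
    simp
  refine Subtype.ext (ext_eta fun b => HilbertModule.ext_inner fun w => ?_)
  refine HilbertModule.denseRange_eta.induction_on
    (p := fun w => inner P w (T.1.1 (HilbertModule.eta E b)) =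
      inner P w ((0 : HilbertModule E →L[ℂ] HilbertModule E) (HilbertModule.eta E b))) w
    (isClosed_eq (by fun_prop) (by fun_prop)) fun a => ?_
  have h1 := hcoeff (star a) b
  have h2 : inner P (HilbertModule.eta E a) (T.1.1 (HilbertModule.eta E b)) = 0 := by
    simpa [coeff] using h1
  rw [h2, zero_apply, ← map_zero (HilbertModule.eta E), HilbertModule.inner_eta]
  simp

/-- `∑ λ(x_i) e_P λ(y_i) ↦ ∑ x_i e y_i` as a completely positive map. -/
def orderZeroMap (h : IsApproxRepresentation E z e r u) :
    basicConstruction E →CP SeqAlgebra A where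
  toLinearMap := amplify E u e
  map_cstarMatrix_nonneg' k _ hM := map_cstarMatrix_nonneg_of_factor h.amplify_star_mul k hM

lemma orderZeroMap_apply (h : IsApproxRepresentation E z e r u) (T : basicConstruction E) :
    h.orderZeroMap T = amplify E u e T := rfl

lemma hasOrderZero_orderZeroMap (h : IsApproxRepresentation E z e r u) :
    HasOrderZero h.orderZeroMap := fun S T _ _ hST => by
  simp only [Orthogonal, orderZeroMap_apply, h.amplify_mul_amplify, hST.1, hST.2, map_zero,
    mul_zero, and_self]

lemma orderZeroMap_incl (h : IsApproxRepresentation E z e r u) (a : A) :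
    h.orderZeroMap (basicConstruction.incl E a) = const a * r := by
  rw [orderZeroMap_apply, ← mul_one (basicConstruction.incl E a), ← sum_jonesElem h.isQuasiBasis,
    Finset.mul_sum, map_sum, ← h.sum_eq, Finset.mul_sum]
  refine Finset.sum_congr rfl fun i _ => ?_
  rw [incl_mul_jonesElem, h.amplify_e, map_mul, map_star]
  simp only [mul_assoc]

lemma orderZeroMap_one (h : IsApproxRepresentation E z e r u) : h.orderZeroMap 1 = r := by
  simpa using h.orderZeroMap_incl 1

end IsApproxRepresentation

end CStarInclusion

end

theorem propositionP {A : Type*} [CStarAlgebra A] [PartialOrder A] [StarOrderedRing A]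
    (P : StarSubalgebra ℂ A) [IsClosed (P : Set A)]
    (E : ConditionalExpectation P) [E.IsIndexFinite]
    (hE : E.HasGenTracialApproxRep) :
    (∀ z : SeqAlgebra A, 0 ≤ z → z ≠ 0 →
      ∃ ψ : basicConstruction E →CP SeqAlgebra A,
        Function.Injective ψ ∧ HasOrderZero ψ ∧
        (∀ a : A, ψ (basicConstruction.incl E a) = SeqAlgebra.const a * ψ 1 ∧
          ψ (basicConstruction.incl E a) = ψ 1 * SeqAlgebra.const a) ∧
        CuntzSubequivalent (1 - ψ 1) z) ∧
    (∀ z : SeqAlgebra A, 0 ≤ z → z ≠ 0 →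
      ∀ (e r : SeqAlgebra A) (n : ℕ) (u : Fin n → A), IsApproxRepresentation E z e r u →
        E.IsQuasiBasis u (fun i => star (u i))) := by
  refine ⟨fun z hz hz0 => ?_, fun z _ _ e r n u h => h.isQuasiBasis⟩
  obtain ⟨e, r, n, u, h⟩ := hE z hz hz0
  refine ⟨h.orderZeroMap, h.amplify_injective, h.hasOrderZero_orderZeroMap, fun a => ?_, ?_⟩
  · rw [h.orderZeroMap_incl, h.orderZeroMap_one, h.r_comm]
    exact ⟨rfl, rfl⟩
  · rw [h.orderZeroMap_one]
    exact h.one_sub_r
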